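/- Let $M\ge 2$ be an integer, $d,\lambda,\rho>0$, $x\in[-1,1]$, and let $j$ denote the imaginary unit. For $v\in\mathbb{R}$ let $$\mathbf a(v)=\left[1,e^{j\frac{2\pi d}{\lambda}v},\ldots,e^{j\frac{2\pi d}{\lambda}(M-1)v}\right]^{\mathrm H}\in\mathbb{C}^M ,$$ where $(\cdot)^{\mathrm H}$ is the Hermitian transpose, and let $f(v,x)=-\frac1{\sqrt M}\operatorname{Im}\{\mathbf a(v)^{\mathrm H}\mathbf a(x)\}$. Call $$\mathcal S(x)=\{v\in(-1,1]: f(v,x)=0,\ \partial_v f(v,x)<0\}$$ the set of stable points. Let $z_1,z_2,\ldots$ be i.i.d. circularly symmetric complex Gaussian random variables with mean zero and variance one, and let $\hat x_0$ be a $[-1,1]$-valued random variable independent of $(z_n)_{n\ge1}$. Let $\alpha>0$ and $N_0\ge0$ be real numbers, and for $n=1,2,\ldots$ let $$\mathbf w_n=\frac{\mathbf a(\hat x_{n-1})}{\sqrt M},\qquad y_n=\mathbf w_n^{\mathrm H}\mathbf a(x)+\frac{z_n}{\sqrt\rho},\qquad \hat x_n=\left[\hat x_{n-1}-a_n\operatorname{Im}\{y_n\}\right]_{-1}^{1},\qquad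 a_n=\frac{\alpha}{n+N_0},$$ where $[u]_b^c=\max\{\min\{u,c\},b\}$. Then $$\mathcal S(x)=\left\{x+\frac{k\lambda}{(M-1)d}: k\in\mathbb{Z}\right\}\cap(-1,1],$$ and, with probability one, the sequence $\hat x_n$ converges to a unique (possibly random) point of $\mathcal S(x)\cup\{-1\}\cup\{1\}$. -/

import Mathlib

open MeasureTheory ProbabilityTheory Filter Topology Matrix

namespace BeamTracking

noncomputable section

/-- The standard circularly symmetric complex Gaussian law `CN(0, 1)`: real and imaginary parts are
independent, each with law `N(0, 1/2)`. -/
def stdComplexGaussian : Measure ℂ :=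
  ((gaussianReal 0 (1 / 2)).prod (gaussianReal 0 (1 / 2))).map
    (fun p : ℝ × ℝ => (⟨p.1, p.2⟩ : ℂ))

/-- The steering vector `a(v) = [1, e^{j (2πd/λ) v}, …, e^{j (2πd/λ)(M-1) v}]ᴴ` of a linear array of
`M` antennas with spacing `d` at wavelength `lam`. It is a column vector, so the Hermitian transpose
of the row conjugates every entry. -/
def steering (M : ℕ) (d lam v : ℝ) : Fin M → ℂ := fun m =>
  star (Complex.exp (Complex.I * ((2 * Real.pi * d / lam * (m : ℕ) * v : ℝ) : ℂ)))

/-- The analog beamforming vector `a(v) / √M`, which points the array in direction `v`. -/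
def beamformer (M : ℕ) (d lam v : ℝ) : Fin M → ℂ :=
  ((1 / Real.sqrt M : ℝ) : ℂ) • steering M d lam v

/-- The observation `y = wᴴ a(x) + z / √ρ`. -/
def observation (M : ℕ) (d lam ρ x : ℝ) (w : Fin M → ℂ) (z : ℂ) : ℂ :=
  star w ⬝ᵥ steering M d lam x + z / ((Real.sqrt ρ : ℝ) : ℂ)

/-- The projection `[u]_b^c = max {min {u, c}, b}`. -/
def clip (b c u : ℝ) : ℝ := max (min u c) b

/-- The step size `a_n = α / (n + N₀)`, used for `n = 1, 2, …`. -/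
def stepSize (α N₀ : ℝ) (n : ℕ) : ℝ := α / (n + N₀)

/-- The recursive beam tracker started at `x₀`: in time-slot `n + 1` the array is steered to the
previous estimate, the observation `y` is received with noise `z n`, and the estimate is updated to
`[x̂ₙ - a_{n+1} Im y]_{-1}^{1}`. -/
def estimate (M : ℕ) (d lam ρ x α N₀ x₀ : ℝ) (z : ℕ → ℂ) : ℕ → ℝ
  | 0 => x₀
  | n + 1 =>
    clip (-1) 1 (estimate M d lam ρ x α N₀ x₀ z n - stepSize α N₀ (n + 1) *
      (observation M d lam ρ x
        (beamformer M d lam (estimate M d lam ρ x α N₀ x₀ z n)) (z n)).im)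

/-- The mean update direction `f(v, x) = -(1/√M) Im {a(v)ᴴ a(x)}`. -/
def drift (M : ℕ) (d lam v x : ℝ) : ℝ :=
  -(1 / Real.sqrt M) * (star (steering M d lam v) ⬝ᵥ steering M d lam x).im

/-- The set `S(x)` of stable points: `v ∈ (-1, 1]` with `f(v, x) = 0` and `∂f/∂v (v, x) < 0`. -/
def stablePoints (M : ℕ) (d lam x : ℝ) : Set ℝ :=
  {v | v ∈ Set.Ioc (-1 : ℝ) 1 ∧ drift M d lam v x = 0 ∧
    deriv (fun u => drift M d lam u x) v < 0}

end

end BeamTracking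

namespace BeamTracking

/-! The tracker is a projected Robbins–Monro scheme for `v' = f v`, where `f` is the drift: the step
sizes have divergent sum and summable squares, and the noise is a multiple of the imaginary part of
a complex Gaussian.

The weighted noise is a convergent random series almost surely, so adding its tail to the iterate
removes the noise: away from the projection, the corrected iterate moves only by the drift. Hence it
eventually stays on one side of any level in `(-1, 1)` where `f` is nonzero. The zeros of `f` are
countable, so such levels are dense and the iterate converges (`IsPerturbedFlow.exists_tendsto`).
Since the step sizes are not summable, an interior limit is a zero of `f`.

Unstable zeros are excluded by comparing two trajectories that differ in a single noise variable.
Where `f` is increasing their gap cannot shrink, so at most one value of that variable leads to a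
given unstable limit, and an atomless law gives it probability zero
(`ae_not_tendsto_of_monotoneOn`).

The zeros are classified by `sin_mul_sinSum`: up to scaling, `f` is `-sin (M t) sin ((M - 1) t) /
sin t`. Zeros of `sin ((M - 1) t)` are stable, and the remaining ones are points of increase
(`cosSum_pos`, `cosSum_neg`). -/

lemma clip_neg_one_one_neg (u : ℝ) : clip (-1) 1 (-u) = -clip (-1) 1 u := by
  unfold clip
  rcases le_total u 1 with h | h <;> rcases le_total (-1) u with h' | h' <;>
    rcases le_total (-u) 1 with h'' | h'' <;> simp [h, h', h''] <;> grind

lemma clip_mem_Icc (u : ℝ) : clip (-1) 1 u ∈ Set.Icc (-1 : ℝ) 1 := by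
  unfold clip
  constructor
  · exact le_max_right _ _
  · exact max_le (min_le_right _ _) (by norm_num)

/-- Only the upper bound of the projection can lower a value; the lower bound can only raise it. -/
lemma le_clip_of_clip_lt {u : ℝ} (h : clip (-1) 1 u < 1) : u ≤ clip (-1) 1 u := by
  unfold clip at *
  grind

lemma clip_eq_self_of_mem_Ioo {u : ℝ} (h : clip (-1) 1 u ∈ Set.Ioo (-1 : ℝ) 1) :
    clip (-1) 1 u = u := by
  obtain ⟨h1, h2⟩ := h
  unfold clip at *
  grind

/-! ### Deterministic convergence of perturbed projected flows -/

/-- A trajectory of the Euler scheme for `v' = f v` with step sizes `a`, kept in `[-1, 1]` by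
projection and perturbed by the increments of a null sequence `T`. -/
structure IsPerturbedFlow (f : ℝ → ℝ) (a T x : ℕ → ℝ) : Prop where
  continuous : Continuous f
  step_nonneg : ∀ n, 0 ≤ a n
  step_tendsto : Tendsto a atTop (𝓝 0)
  tail_tendsto : Tendsto T atTop (𝓝 0)
  mem_Icc : ∀ n, x n ∈ Set.Icc (-1 : ℝ) 1
  succ : ∀ n, x (n + 1) = clip (-1) 1 (x n + a n * f (x n) + (T n - T (n + 1)))

namespace IsPerturbedFlow

variable {f : ℝ → ℝ} {a T x : ℕ → ℝ}

/-- Reflection turns each upward statement below into its downward counterpart. -/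
lemma neg (h : IsPerturbedFlow f a T x) :
    IsPerturbedFlow (fun v => -f (-v)) a (fun n => -T n) (fun n => -x n) where
  continuous := (h.continuous.comp continuous_neg).neg
  step_nonneg := h.step_nonneg
  step_tendsto := h.step_tendsto
  tail_tendsto := by simpa using h.tail_tendsto.neg
  mem_Icc n := by
    have := h.mem_Icc n
    constructor <;> linarith [this.1, this.2]
  succ n := by
    rw [h.succ, ← clip_neg_one_one_neg]
    congr 1
    simp
    ring

lemma tendsto_step_mul (h : IsPerturbedFlow f a T x) :
    Tendsto (fun n => a n * f (x n)) atTop (𝓝 0) := by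
  obtain ⟨B, hB⟩ := isCompact_Icc.exists_bound_of_continuousOn
    (h.continuous.continuousOn (s := Set.Icc (-1 : ℝ) 1))
  refine squeeze_zero_norm (a := fun n => a n * B) (fun n => ?_) (by simpa using h.step_tendsto.mul_const B)
  rw [norm_mul, Real.norm_of_nonneg (h.step_nonneg n)]
  exact mul_le_mul_of_nonneg_left (hB _ (h.mem_Icc n)) (h.step_nonneg n)

/-- Positive drift near `c` makes the level a one-way barrier for `x n + T n`: below `c + δ` the
drift cannot push down, and from farther above one small step cannot reach `c`. -/
lemma eventually_ge_or_lt (h : IsPerturbedFlow f a T x) {c : ℝ} (hc : c < 1) (hf : 0 < f c) :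
    (∀ᶠ n in atTop, c ≤ x n + T n) ∨ ∀ᶠ n in atTop, x n + T n < c := by
  obtain ⟨δ, hδ, hfδ⟩ := Metric.eventually_nhds_iff.1
    (h.continuous.continuousAt.eventually (lt_mem_nhds hf))
  have e1 := h.tail_tendsto.eventually (Ioo_mem_nhds (show -(δ / 4) < 0 by linarith)
    (show 0 < δ / 4 by linarith))
  have e2 := h.tendsto_step_mul.eventually (lt_mem_nhds (show -(δ / 4) < 0 by linarith))
  -- This bound covers the case where the projection puts the next iterate at `1`.
  have e3 := h.tail_tendsto.eventually (lt_mem_nhds (show c - 1 < 0 by linarith))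
  obtain ⟨N, hN⟩ := eventually_atTop.1 (e1.and (e2.and e3))
  by_cases hex : ∃ n, N ≤ n ∧ c ≤ x n + T n
  · left
    obtain ⟨n₀, hn₀, hy⟩ := hex
    refine eventually_atTop.2 ⟨n₀, fun n hn => ?_⟩
    induction n, hn using Nat.le_induction with
    | base => exact hy
    | succ n hn ih =>
      obtain ⟨⟨t1, t2⟩, t3, -⟩ := hN n (hn₀.trans hn)
      obtain ⟨-, -, t4⟩ := hN (n + 1) (by omega)
      by_cases hcl : x (n + 1) < 1
      · have hle : x n + a n * f (x n) + (T n - T (n + 1)) ≤ x (n + 1) := by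
          rw [h.succ] at hcl ⊢
          exact le_clip_of_clip_lt hcl
        by_cases hx : x n < c + δ
        · have := hfδ (y := x n) (by rw [Real.dist_eq, abs_lt]; constructor <;> linarith)
          have := mul_nonneg (h.step_nonneg n) this.le
          linarith
        · linarith
      · linarith
  · right
    push Not at hex
    exact eventually_atTop.2 ⟨N, hex⟩

lemma exists_tendsto (h : IsPerturbedFlow f a T x) (hz : {v | f v = 0}.Countable) :
    ∃ L ∈ Set.Icc (-1 : ℝ) 1, Tendsto x atTop (𝓝 L) := by
  have hsub : ∃ c, Tendsto (fun n => x n + T n) atTop (𝓝 c) := by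
    have hb : ∀ᶠ n in atTop, -1 < T n ∧ T n < 1 :=
      h.tail_tendsto.eventually (Ioo_mem_nhds (by norm_num) (by norm_num))
    -- Besides the zeros, `1` and `-1` are removed from the levels because the barrier lemma and its
    -- reflection require a level strictly inside the interval.
    refine tendsto_of_no_upcrossings
      ((hz.union (Set.countable_singleton 1) |>.union (Set.countable_singleton (-1))).dense_compl ℝ)
      ?_ ?_ ?_
    · intro p hp q hq hpq ⟨hfp, hfq⟩
      simp only [Set.mem_compl_iff, Set.mem_union, Set.mem_ofPred_eq, Set.mem_singleton_iff,
        not_or] at hp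
      rcases lt_or_gt_of_ne hp.1.2 with hp1 | hp1
      · rcases lt_or_gt_of_ne hp.2 with hp2 | hp2
        · have := h.tail_tendsto.eventually (lt_mem_nhds (show p + 1 < 0 by linarith))
          refine hfp (this.mono fun n hn => ?_)
          linarith [(h.mem_Icc n).1]
        · rcases lt_or_gt_of_ne hp.1.1 with hp0 | hp0
          · rcases h.neg.eventually_ge_or_lt (c := -p) (by linarith) (by simpa using hp0) with H | H
            · exact hfq (H.mono fun n hn => by simp at hn; linarith)
            · exact hfp (H.mono fun n hn => by simp at hn; linarith)
          · rcases h.eventually_ge_or_lt hp1 hp0 with H | H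
            · exact hfp (H.mono fun n hn => by linarith)
            · exact hfq (H.mono fun n hn => by linarith)
      · have := h.tail_tendsto.eventually (gt_mem_nhds (show 0 < q - 1 by linarith))
        refine hfq (this.mono fun n hn => ?_)
        linarith [(h.mem_Icc n).2]
    · exact ⟨2, eventually_map.2 (hb.mono fun n hn => by linarith [(h.mem_Icc n).2])⟩
    · exact ⟨-2, eventually_map.2 (hb.mono fun n hn => by
        show -2 ≤ _
        linarith [(h.mem_Icc n).1])⟩
  obtain ⟨L, hL⟩ := hsub
  have hx : Tendsto x atTop (𝓝 L) := by simpa using hL.sub h.tail_tendsto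
  exact ⟨L, isClosed_Icc.mem_of_tendsto hx (Eventually.of_forall h.mem_Icc), hx⟩

/-- If `f L` were positive, `x n + T n` would eventually gain at least `a n * (f L / 2)` per step,
and boundedness would make `a` summable. -/
lemma nonpos_of_tendsto (h : IsPerturbedFlow f a T x) (ha : ¬ Summable a) {L : ℝ}
    (hL : Tendsto x atTop (𝓝 L)) (hL1 : L < 1) : f L ≤ 0 := by
  by_contra! hf
  have e1 := (h.continuous.continuousAt.tendsto.comp hL).eventually
    (lt_mem_nhds (show f L / 2 < f L by linarith))
  have e2 := hL.eventually (gt_mem_nhds hL1)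
  have e3 := h.tail_tendsto.eventually (gt_mem_nhds one_pos)
  obtain ⟨N, hN⟩ := eventually_atTop.1 (e1.and (e2.and e3))
  have key : ∀ n, x N + T N + ∑ i ∈ Finset.range n, a (i + N) * (f L / 2) ≤
      x (n + N) + T (n + N) := by
    intro n
    induction n with
    | zero => simp
    | succ n ih =>
      rw [Finset.sum_range_succ, show n + 1 + N = n + N + 1 by ring]
      obtain ⟨t1, -, -⟩ := hN (n + N) (by omega)
      obtain ⟨-, t2, -⟩ := hN (n + N + 1) (by omega)
      have hle : x (n + N) + a (n + N) * f (x (n + N)) + (T (n + N) - T (n + N + 1)) ≤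
          x (n + N + 1) := by
        rw [h.succ] at t2 ⊢
        exact le_clip_of_clip_lt t2
      have := mul_le_mul_of_nonneg_left t1.le (h.step_nonneg (n + N))
      simp only [Function.comp] at this
      linarith
  have hs : Summable fun i => a (i + N) * (f L / 2) := by
    refine summable_of_sum_range_le (c := 2 - (x N + T N))
      (fun i => mul_nonneg (h.step_nonneg _) (by linarith)) fun n => ?_
    obtain ⟨-, -, t3⟩ := hN (n + N) (by omega)
    linarith [key n, (h.mem_Icc (n + N)).2]
  rw [summable_mul_right_iff (by linarith), summable_nat_add_iff] at hs
  exact ha hs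

lemma eq_zero_of_tendsto (h : IsPerturbedFlow f a T x) (ha : ¬ Summable a) {L : ℝ}
    (hL : Tendsto x atTop (𝓝 L)) (hL1 : L ∈ Set.Ioo (-1 : ℝ) 1) : f L = 0 := by
  refine le_antisymm (h.nonpos_of_tendsto ha hL hL1.2) ?_
  simpa using h.neg.nonpos_of_tendsto ha hL.neg (by linarith [hL1.1])

end IsPerturbedFlow

/-! ### The stochastic scheme and its noise series -/

/-- The projected stochastic approximation scheme with mean field `f`, step sizes `a` and
noise `ξ`. -/
noncomputable def projIter (f : ℝ → ℝ) (a : ℕ → ℝ) (x₀ : ℝ) (ξ : ℕ → ℝ) : ℕ → ℝ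
  | 0 => x₀
  | n + 1 => clip (-1) 1 (projIter f a x₀ ξ n + a n * (f (projIter f a x₀ ξ n) + ξ n))

variable {f : ℝ → ℝ} {a : ℕ → ℝ}

lemma projIter_mem_Icc {x₀ : ℝ} (hx₀ : x₀ ∈ Set.Icc (-1 : ℝ) 1) (ξ : ℕ → ℝ) :
    ∀ n, projIter f a x₀ ξ n ∈ Set.Icc (-1 : ℝ) 1
  | 0 => hx₀
  | _ + 1 => clip_mem_Icc _

lemma projIter_congr (x₀ : ℝ) {ξ ξ' : ℕ → ℝ} {k : ℕ} (h : ∀ i < k, ξ i = ξ' i) :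
    projIter f a x₀ ξ k = projIter f a x₀ ξ' k := by
  induction k with
  | zero => rfl
  | succ k ih =>
    simp only [projIter]
    rw [ih fun i hi => h i (by omega), h k (by omega)]

/-- The perturbation is the tail of the noise series, whose successive differences are `a n * ξ n`.
-/
lemma isPerturbedFlow_projIter (hf : Continuous f) (ha : ∀ n, 0 ≤ a n)
    (ha0 : Tendsto a atTop (𝓝 0)) {x₀ : ℝ} (hx₀ : x₀ ∈ Set.Icc (-1 : ℝ) 1) {ξ : ℕ → ℝ} {c : ℝ}
    (hc : Tendsto (fun n => ∑ i ∈ Finset.range n, a i * ξ i) atTop (𝓝 c)) :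
    IsPerturbedFlow f a (fun n => c - ∑ i ∈ Finset.range n, a i * ξ i) (projIter f a x₀ ξ) where
  continuous := hf
  step_nonneg := ha
  step_tendsto := ha0
  tail_tendsto := by simpa using hc.const_sub c
  mem_Icc := projIter_mem_Icc hx₀ ξ
  succ n := by
    rw [projIter, Finset.sum_range_succ]
    congr 1
    ring

/-- In a region where the mean field is monotone, two trajectories driven by the same noise do not
approach each other. -/
lemma sub_le_sub_of_monotoneOn (ha : ∀ n, 0 ≤ a n) {U : Set ℝ} (hU : U ⊆ Set.Ioo (-1 : ℝ) 1)
    (hf : MonotoneOn f U) {x y ξ : ℕ → ℝ} (hx : ∀ n, x n ∈ U) (hy : ∀ n, y n ∈ U)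
    (hx' : ∀ n, x (n + 1) = clip (-1) 1 (x n + a n * (f (x n) + ξ n)))
    (hy' : ∀ n, y (n + 1) = clip (-1) 1 (y n + a n * (f (y n) + ξ n)))
    (h0 : x 0 ≤ y 0) (n : ℕ) : y 0 - x 0 ≤ y n - x n := by
  induction n with
  | zero => rfl
  | succ n ih =>
    have h1 := hx' n ▸ hU (hx (n + 1))
    have h2 := hy' n ▸ hU (hy (n + 1))
    rw [hx', hy', clip_eq_self_of_mem_Ioo h1, clip_eq_self_of_mem_Ioo h2]
    have := mul_le_mul_of_nonneg_left (hf (hx n) (hy n) (by linarith)) (ha n)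
    linarith

/-- Partial sums of independent centered square integrable variables with bounded total variance
converge almost surely. -/
lemma ae_exists_tendsto_sum {Ω : Type*} [MeasurableSpace Ω] {μ : Measure Ω}
    [IsProbabilityMeasure μ] {Y : ℕ → Ω → ℝ} (hm : ∀ i, StronglyMeasurable (Y i))
    (hi : iIndepFun Y μ) (hL : ∀ i, MemLp (Y i) 2 μ) (h0 : ∀ i, ∫ ω, Y i ω ∂μ = 0)
    (hV : Summable fun i => Var[Y i; μ]) :
    ∀ᵐ ω ∂μ, ∃ c, Tendsto (fun n => ∑ i ∈ Finset.range n, Y i ω) atTop (𝓝 c) := by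
  -- The sum includes index `n`, so that `S n` is adapted to the natural filtration at time `n`.
  let S : ℕ → Ω → ℝ := fun n => ∑ i ∈ Finset.range (n + 1), Y i
  have hSL : ∀ n, MemLp (S n) 2 μ := fun n => memLp_finsetSum' _ fun i _ => hL i
  have hSi : ∀ n, Integrable (S n) μ := fun n => (hSL n).integrable one_le_two
  have hS0 : ∀ n, ∫ ω, S n ω ∂μ = 0 := fun n => by
    simp only [S, Finset.sum_apply]
    rw [integral_finsetSum _ fun i _ => (hL i).integrable one_le_two]
    simp [h0]
  have hmart : Martingale S (Filtration.natural Y hm) μ := by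
    have had : StronglyAdapted (Filtration.natural Y hm) S := fun n =>
      Finset.stronglyMeasurable_sum _ fun i hi =>
        ((Filtration.stronglyAdapted_natural hm) i).mono
          ((Filtration.natural Y hm).mono (Nat.lt_succ_iff.1 (Finset.mem_range.1 hi)))
    refine martingale_nat had hSi fun n => ?_
    have hS : S (n + 1) = S n + Y (n + 1) := Finset.sum_range_succ _ _
    rw [hS]
    have h1 := condExp_add (hSi n) ((hL (n + 1)).integrable one_le_two)
      (Filtration.natural Y hm n)
    have h2 := hi.condExp_natural_ae_eq_of_lt hm (Nat.lt_succ_self n)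
    have h3 := condExp_of_stronglyMeasurable ((Filtration.natural Y hm).le n) (had n) (hSi n)
    filter_upwards [h1, h2] with ω h1 h2
    rw [h1, Pi.add_apply, h2, h3, h0, add_zero]
  have hvar : ∀ n, ∫ ω, S n ω ^ 2 ∂μ ≤ ∑' i, Var[Y i; μ] := fun n => by
    have h1 := variance_of_integral_eq_zero (hSL n).aemeasurable (hS0 n)
    rw [← h1, IndepFun.variance_sum (fun i _ => hL i) fun i _ j _ hij => hi.indepFun hij]
    exact hV.sum_le_tsum _ fun i _ => variance_nonneg _ _
  -- The variance bound becomes an `L¹` bound through `|s| ≤ 1 + s ^ 2`, as martingale convergence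
  -- requires.
  have hbdd : ∀ n, eLpNorm (S n) 1 μ ≤ (Real.toNNReal (1 + ∑' i, Var[Y i; μ]) : NNReal) := by
    intro n
    rw [eLpNorm_one_eq_lintegral_enorm, ← ofReal_integral_norm_eq_lintegral_enorm (hSi n)]
    refine ENNReal.ofReal_le_ofReal ?_
    calc ∫ ω, ‖S n ω‖ ∂μ ≤ ∫ ω, (1 + S n ω ^ 2) ∂μ := by
          refine integral_mono (hSi n).norm ((integrable_const 1).add (hSL n).integrable_sq) ?_
          intro ω
          show |S n ω| ≤ 1 + S n ω ^ 2
          nlinarith [sq_abs (S n ω), sq_nonneg (|S n ω| - 1), abs_nonneg (S n ω)]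
      _ = 1 + ∫ ω, S n ω ^ 2 ∂μ := by
          rw [integral_add (integrable_const 1) (hSL n).integrable_sq]
          simp
      _ ≤ _ := by linarith [hvar n]
  filter_upwards [hmart.submartingale.exists_ae_tendsto_of_bdd hbdd] with ω ⟨c, hc⟩
  refine ⟨c, (tendsto_add_atTop_iff_nat 1).1 ?_⟩
  simpa [S] using hc

/-! ### Almost sure behaviour on the product space -/

section Canonical

variable (ν γ : Measure ℝ) [IsProbabilityMeasure γ]

lemma ae_exists_tendsto_noise (hγ2 : MemLp id 2 γ) (hγ0 : ∫ t, t ∂γ = 0) {a : ℕ → ℝ}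
    (ha : Summable fun n => a n ^ 2) :
    ∀ᵐ ξ ∂Measure.infinitePi (fun _ : ℕ => γ),
      ∃ c, Tendsto (fun n => ∑ i ∈ Finset.range n, a i * ξ i) atTop (𝓝 c) := by
  set π := Measure.infinitePi fun _ : ℕ => γ with hπ
  have hlaw : ∀ i, HasLaw (fun ξ : ℕ → ℝ => ξ i) γ π := fun i =>
    (measurePreserving_eval_infinitePi (fun _ : ℕ => γ) i).hasLaw
  have hL : ∀ i, MemLp (fun ξ : ℕ → ℝ => ξ i) 2 π := fun i =>
    hγ2.comp_measurePreserving (measurePreserving_eval_infinitePi (fun _ : ℕ => γ) i)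
  have hind : iIndepFun (fun i (ξ : ℕ → ℝ) => a i * ξ i) π :=
    iIndepFun_infinitePi (P := fun _ : ℕ => γ) (X := fun i t => a i * t)
      fun i => measurable_const_mul _
  have hvar : ∀ i, Var[fun ξ : ℕ → ℝ => a i * ξ i; π] = a i ^ 2 * Var[id; γ] := fun i => by
    rw [variance_const_mul, (hlaw i).variance_eq]
  refine ae_exists_tendsto_sum
    (fun i => (measurable_const.mul (measurable_pi_apply i)).stronglyMeasurable)
    hind (fun i => (hL i).const_mul _) (fun i => ?_) ?_
  · rw [integral_const_mul, (hlaw i).integral_eq, hγ0, mul_zero]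
  · simp only [hvar]
    exact ha.mul_right _

lemma measurable_update_prod (k : ℕ) :
    Measurable fun q : (ℕ → ℝ) × ℝ => Function.update q.1 k q.2 := by
  refine measurable_pi_iff.2 fun i => ?_
  by_cases hi : i = k
  · subst hi
    simpa using measurable_snd
  · simp only [Function.update_of_ne hi]
    exact (measurable_pi_apply i).comp measurable_fst

/-- Resampling one coordinate preserves a product measure. -/
lemma infinitePi_prod_map_update (k : ℕ) :
    ((Measure.infinitePi fun _ : ℕ => γ).prod γ).map (fun q => Function.update q.1 k q.2) =
      Measure.infinitePi fun _ : ℕ => γ := by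
  have hmeas := measurable_update_prod k
  refine Measure.eq_infinitePi _ fun s t ht => ?_
  rw [Measure.map_apply hmeas (.pi s.countable_toSet fun _ _ => ht _)]
  have hpre : (fun q : (ℕ → ℝ) × ℝ => Function.update q.1 k q.2) ⁻¹' ((s : Set ℕ).pi t) =
      ((s.erase k : Finset ℕ) : Set ℕ).pi t ×ˢ (if k ∈ s then t k else Set.univ) := by
    ext q
    simp only [Set.mem_preimage, Set.mem_pi, Finset.mem_coe, Set.mem_prod, Finset.mem_erase]
    constructor
    · intro h
      refine ⟨fun i hi => by simpa [hi.1] using h i hi.2, ?_⟩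
      split_ifs with hk
      · simpa using h k hk
      · trivial
    · rintro ⟨h1, h2⟩ i hi
      by_cases hik : i = k
      · subst hik; simpa [hi] using h2
      · simpa [hik] using h1 i ⟨hik, hi⟩
  rw [hpre, Measure.prod_prod, Measure.infinitePi_pi _ fun i _ => ht i]
  split_ifs with hk
  · rw [mul_comm, Finset.mul_prod_erase s (fun i => γ (t i)) hk]
  · rw [Finset.erase_eq_of_notMem hk, measure_univ, mul_one]

variable {f : ℝ → ℝ} {a : ℕ → ℝ}

lemma measurable_projIter (hf : Continuous f) (n : ℕ) :
    Measurable fun p : ℝ × (ℕ → ℝ) => projIter f a p.1 p.2 n := by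
  induction n with
  | zero => exact measurable_fst
  | succ n ih =>
    have h1 : Measurable fun p : ℝ × (ℕ → ℝ) => p.2 n := (measurable_pi_apply n).comp measurable_snd
    exact (((ih.add (((hf.measurable.comp ih).add h1).const_mul (a n))).min measurable_const).max
      measurable_const)

/-- When all noise variables but one are fixed, at most one value of the remaining one makes the
trajectory converge to `L` while staying where the mean field is increasing. -/
lemma subsingleton_setOf_tendsto_update (ha : ∀ n, 0 < a n) {U : Set ℝ}
    (hU : U ⊆ Set.Ioo (-1 : ℝ) 1) (hf : MonotoneOn f U) (L x₀ : ℝ) (ξ : ℕ → ℝ) (k : ℕ) :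
    {t | Tendsto (projIter f a x₀ (Function.update ξ k t)) atTop (𝓝 L) ∧
      ∀ n, k + 1 ≤ n → projIter f a x₀ (Function.update ξ k t) n ∈ U}.Subsingleton := by
  -- The two trajectories agree up to time `k`, are strictly ordered at time `k + 1`, and keep at
  -- least that gap, so they cannot share a limit.
  have key : ∀ s t, s < t →
      (Tendsto (projIter f a x₀ (Function.update ξ k s)) atTop (𝓝 L) ∧
        ∀ n, k + 1 ≤ n → projIter f a x₀ (Function.update ξ k s) n ∈ U) →
      (Tendsto (projIter f a x₀ (Function.update ξ k t)) atTop (𝓝 L) ∧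
        ∀ n, k + 1 ≤ n → projIter f a x₀ (Function.update ξ k t) n ∈ U) → False := by
    rintro s t hst ⟨hs, hsU⟩ ⟨ht, htU⟩
    have h0 : projIter f a x₀ (Function.update ξ k s) (k + 1) <
        projIter f a x₀ (Function.update ξ k t) (k + 1) := by
      have h1 := hU (hsU (k + 1) le_rfl)
      have h2 := hU (htU (k + 1) le_rfl)
      have hcg : projIter f a x₀ (Function.update ξ k s) k =
          projIter f a x₀ (Function.update ξ k t) k :=
        projIter_congr x₀ fun i hi => by simp [hi.ne]
      rw [projIter] at h1 h2 ⊢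
      rw [projIter, clip_eq_self_of_mem_Ioo h1, clip_eq_self_of_mem_Ioo h2, hcg]
      simp only [Function.update_self]
      have := mul_lt_mul_of_pos_left hst (ha k)
      linarith
    have hstep : ∀ u n, projIter f a x₀ (Function.update ξ k u) (n + 1 + (k + 1)) =
        clip (-1) 1 (projIter f a x₀ (Function.update ξ k u) (n + (k + 1)) + a (n + (k + 1)) *
          (f (projIter f a x₀ (Function.update ξ k u) (n + (k + 1))) + ξ (n + (k + 1)))) := by
      intro u n
      rw [show n + 1 + (k + 1) = n + (k + 1) + 1 by ring, projIter,
        Function.update_of_ne (a := n + (k + 1)) (by omega)]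
    have hsep := sub_le_sub_of_monotoneOn (a := fun n => a (n + (k + 1)))
      (ξ := fun n => ξ (n + (k + 1))) (fun n => (ha _).le) hU hf
      (fun n => hsU (n + (k + 1)) (by omega)) (fun n => htU (n + (k + 1)) (by omega))
      (hstep s) (hstep t) (by simpa using h0.le)
    have hlim := ((tendsto_add_atTop_iff_nat (k + 1)).2 ht).sub
      ((tendsto_add_atTop_iff_nat (k + 1)).2 hs)
    have := ge_of_tendsto' hlim hsep
    simp only [zero_add] at this
    linarith
  intro s hs t ht
  rcases lt_trichotomy s t with h | h | h
  · exact (key s t h hs ht).elim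
  · exact h
  · exact (key t s h ht hs).elim

/-- The scheme does not converge to an interior point near which the mean field is increasing. -/
lemma ae_not_tendsto_of_monotoneOn [NullSingletonClass γ] (hf : Continuous f) (ha : ∀ n, 0 < a n) {L : ℝ}
    (hL : L ∈ Set.Ioo (-1 : ℝ) 1) {U : Set ℝ} (hU : U ∈ 𝓝 L) (hfU : MonotoneOn f U) :
    ∀ᵐ p ∂ν.prod (Measure.infinitePi fun _ : ℕ => γ),
      ¬ Tendsto (projIter f a p.1 p.2) atTop (𝓝 L) := by
  obtain ⟨r, hr, hrU⟩ := Metric.mem_nhds_iff.1 (inter_mem hU (isOpen_Ioo.mem_nhds hL))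
  set V := Metric.ball L r with hV
  -- A trajectory converging to `L` lies in some `B k`, so it suffices that each of these countably
  -- many events is null.
  let B : ℕ → Set (ℝ × (ℕ → ℝ)) := fun k => {p | Tendsto (projIter f a p.1 p.2) atTop (𝓝 L) ∧
      ∀ n, k + 1 ≤ n → projIter f a p.1 p.2 n ∈ V}
  have hBm : ∀ k, MeasurableSet (B k) := fun k => by
    refine (measurableSet_tendsto (𝓝 L) fun n => measurable_projIter hf n).inter ?_
    have : {p : ℝ × (ℕ → ℝ) | ∀ n, k + 1 ≤ n → projIter f a p.1 p.2 n ∈ V} =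
        ⋂ n, ⋂ (_ : k + 1 ≤ n), (fun p : ℝ × (ℕ → ℝ) => projIter f a p.1 p.2 n) ⁻¹' V := by
      ext; simp
    change MeasurableSet {p : ℝ × (ℕ → ℝ) | ∀ n, k + 1 ≤ n → projIter f a p.1 p.2 n ∈ V}
    rw [this]
    exact .iInter fun n => .iInter fun _ => measurable_projIter hf n measurableSet_ball
  have hB0 : ∀ k, ν.prod (Measure.infinitePi fun _ : ℕ => γ) (B k) = 0 := fun k => by
    rw [Measure.measure_prod_null (hBm k)]
    refine Eventually.of_forall fun x₀ => ?_
    have hupd := measurable_update_prod k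
    have hsec : MeasurableSet (Prod.mk x₀ ⁻¹' B k) := measurable_prodMk_left (hBm k)
    change (Measure.infinitePi fun _ : ℕ => γ) (Prod.mk x₀ ⁻¹' B k) = 0
    -- After coordinate `k` is resampled, Fubini reduces the claim to one-dimensional sections,
    -- which have at most one point.
    rw [← infinitePi_prod_map_update γ k, Measure.map_apply hupd hsec,
      Measure.measure_prod_null (hupd hsec)]
    refine Eventually.of_forall fun ξ => Set.Subsingleton.measure_zero ?_ γ
    exact subsingleton_setOf_tendsto_update ha (fun v hv => (hrU hv).2)
      (hfU.mono fun v hv => (hrU hv).1) L x₀ ξ k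
  have hall := ae_all_iff.2 fun k => measure_eq_zero_iff_ae_notMem.1 (hB0 k)
  filter_upwards [hall] with p hp ht
  obtain ⟨N, hN⟩ := eventually_atTop.1 (ht.eventually (Metric.ball_mem_nhds L hr))
  exact hp N ⟨ht, fun n hn => hN n (by omega)⟩

/-- Almost sure convergence of the projected stochastic approximation scheme to a boundary point or
to a zero of the mean field which is not a point of increase. -/
theorem ae_exists_tendsto_projIter [IsProbabilityMeasure ν] [NullSingletonClass γ] (hγ2 : MemLp id 2 γ) (hγ0 : ∫ t, t ∂γ = 0)
    (hν : ∀ᵐ x₀ ∂ν, x₀ ∈ Set.Icc (-1 : ℝ) 1) (hf : Continuous f) (hz : {v | f v = 0}.Countable)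
    (ha : ∀ n, 0 < a n) (ha0 : Tendsto a atTop (𝓝 0)) (ha1 : ¬ Summable a)
    (ha2 : Summable fun n => a n ^ 2) :
    ∀ᵐ p ∂ν.prod (Measure.infinitePi fun _ : ℕ => γ),
      ∃ L ∈ Set.Icc (-1 : ℝ) 1, Tendsto (projIter f a p.1 p.2) atTop (𝓝 L) ∧
        (L ∈ Set.Ioo (-1 : ℝ) 1 → f L = 0 ∧ ∀ U ∈ 𝓝 L, ¬ MonotoneOn f U) := by
  have h1 := Measure.quasiMeasurePreserving_fst (μ := ν)
    (ν := Measure.infinitePi fun _ : ℕ => γ) |>.ae hν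
  have h2 := Measure.quasiMeasurePreserving_snd (μ := ν)
    (ν := Measure.infinitePi fun _ : ℕ => γ) |>.ae (ae_exists_tendsto_noise γ hγ2 hγ0 ha2)
  have h3 := (ae_ball_iff hz).2 fun L (_ : L ∈ {v | f v = 0}) =>
    show ∀ᵐ p ∂ν.prod (Measure.infinitePi fun _ : ℕ => γ),
      L ∈ Set.Ioo (-1 : ℝ) 1 → (∃ U ∈ 𝓝 L, MonotoneOn f U) →
        ¬ Tendsto (projIter f a p.1 p.2) atTop (𝓝 L) by
    by_cases hL : L ∈ Set.Ioo (-1 : ℝ) 1 ∧ ∃ U ∈ 𝓝 L, MonotoneOn f U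
    · obtain ⟨hL, U, hU, hfU⟩ := hL
      filter_upwards [ae_not_tendsto_of_monotoneOn ν γ hf ha hL hU hfU] with p hp _ _ using hp
    · exact Eventually.of_forall fun p h h' => (hL ⟨h, h'⟩).elim
  filter_upwards [h1, h2, h3] with p hp1 ⟨c, hc⟩ hp3
  have hflow := isPerturbedFlow_projIter hf (fun n => (ha n).le) ha0 hp1 hc
  obtain ⟨L, hL, hxL⟩ := hflow.exists_tendsto hz
  refine ⟨L, hL, hxL, fun hLo => ?_⟩
  have hfL := hflow.eq_zero_of_tendsto ha1 hxL hLo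
  exact ⟨hfL, fun U hU hfU => hp3 L hfL hLo ⟨U, hU, hfU⟩ hxL⟩

end Canonical

/-! ### The trigonometric sum behind the drift -/

/-- The sum `∑ m < M, sin (2 m t)`. -/
noncomputable def sinSum (M : ℕ) (t : ℝ) : ℝ := ∑ m ∈ Finset.range M, Real.sin (2 * m * t)

/-- The derivative of `sinSum`. -/
noncomputable def cosSum (M : ℕ) (t : ℝ) : ℝ :=
  ∑ m ∈ Finset.range M, 2 * m * Real.cos (2 * m * t)

lemma hasDerivAt_sinSum (M : ℕ) (t : ℝ) : HasDerivAt (sinSum M) (cosSum M t) t := by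
  unfold sinSum cosSum
  refine HasDerivAt.fun_sum fun m _ => ?_
  have := ((hasDerivAt_id t).const_mul (2 * (m : ℝ))).sin
  simpa [mul_comm] using this

lemma continuous_cosSum (M : ℕ) : Continuous (cosSum M) := by
  unfold cosSum
  fun_prop

lemma sin_mul_sinSum (M : ℕ) (t : ℝ) :
    Real.sin t * sinSum M t = Real.sin (M * t) * Real.sin ((M - 1) * t) := by
  unfold sinSum
  induction M with
  | zero => simp
  | succ M ih =>
    rw [Finset.sum_range_succ, mul_add, ih]
    have e1 : ((M + 1 : ℕ) : ℝ) * t = M * t + t := by push_cast; ring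
    have e2 : (((M + 1 : ℕ) : ℝ) - 1) * t = M * t := by push_cast; ring
    have e3 : ((M : ℝ) - 1) * t = M * t - t := by ring
    have e4 : 2 * (M : ℝ) * t = 2 * (M * t) := by ring
    rw [e1, e2, e3, e4, Real.sin_add, Real.sin_sub, Real.sin_two_mul]
    ring

/-- Both sides are the derivative of the product in `sin_mul_sinSum`. -/
lemma cos_mul_sinSum_add (M : ℕ) (t : ℝ) :
    Real.cos t * sinSum M t + Real.sin t * cosSum M t =
      M * Real.cos (M * t) * Real.sin ((M - 1) * t) +
        (M - 1) * Real.sin (M * t) * Real.cos ((M - 1) * t) := by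
  have h1 := (Real.hasDerivAt_sin t).mul (hasDerivAt_sinSum M t)
  have h2 := (((hasDerivAt_id t).const_mul (M : ℝ)).sin).mul
    (((hasDerivAt_id t).const_mul ((M : ℝ) - 1)).sin)
  have h3 : (fun t => Real.sin t * sinSum M t) =
      fun t => Real.sin (M * t) * Real.sin ((M - 1) * t) := funext (sin_mul_sinSum M)
  have h4 : HasDerivAt (fun t => Real.sin t * sinSum M t) _ t := h1
  rw [h3] at h4
  have := h4.unique h2
  simp only [id, mul_one] at this
  linarith

lemma sin_nat_mul_eq_zero {t : ℝ} (ht : Real.sin t = 0) (n : ℕ) : Real.sin (n * t) = 0 := by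
  obtain ⟨k, rfl⟩ := Real.sin_eq_zero_iff.1 ht
  exact Real.sin_eq_zero_iff.2 ⟨n * k, by push_cast; ring⟩

lemma sinSum_eq_zero_of_sin {M : ℕ} {t : ℝ} (h : Real.sin ((M - 1) * t) = 0) :
    sinSum M t = 0 := by
  by_cases ht : Real.sin t = 0
  · refine Finset.sum_eq_zero fun m _ => ?_
    simpa using sin_nat_mul_eq_zero ht (2 * m)
  · have := sin_mul_sinSum M t
    rw [h, mul_zero] at this
    exact (mul_eq_zero.1 this).resolve_left ht

/-- If `sin t ≠ 0`, the differentiated identity gives `cosSum M t = (M - 1) cos² ((M - 1) t)`, and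
the cosine is `±1`; if `sin t = 0`, every cosine in the sum is `1`. -/
lemma cosSum_pos {M : ℕ} (hM : 2 ≤ M) {t : ℝ} (h : Real.sin ((M - 1) * t) = 0) :
    0 < cosSum M t := by
  have hM' : (2 : ℝ) ≤ M := by exact_mod_cast hM
  by_cases ht : Real.sin t = 0
  · obtain ⟨k, rfl⟩ := Real.sin_eq_zero_iff.1 ht
    have hc : ∀ m : ℕ, Real.cos (2 * m * (k * Real.pi)) = 1 := fun m => by
      rw [show 2 * (m : ℝ) * (k * Real.pi) = ((m * k : ℤ) : ℝ) * (2 * Real.pi) by push_cast; ring]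
      exact Real.cos_int_mul_two_pi _
    unfold cosSum
    simp only [hc]
    exact Finset.sum_pos' (fun i _ => by positivity)
      ⟨1, Finset.mem_range.2 (by omega), by norm_num⟩
  · have h1 := cos_mul_sinSum_add M t
    rw [sinSum_eq_zero_of_sin h, h, mul_zero, mul_zero, zero_add, zero_add,
      show (M : ℝ) * t = (M - 1) * t + t by ring, Real.sin_add, h, zero_mul, zero_add] at h1
    have h2 : cosSum M t = (M - 1) * Real.cos ((M - 1) * t) ^ 2 := by
      apply mul_left_cancel₀ ht
      rw [h1]
      ring
    have h3 := Real.sin_sq_add_cos_sq ((M - 1) * t)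
    rw [h] at h3
    rw [h2]
    nlinarith

lemma sin_natCast_mul_eq_zero_of_sinSum {M : ℕ} {t : ℝ} (h : sinSum M t = 0)
    (h' : Real.sin ((M - 1) * t) ≠ 0) : Real.sin (M * t) = 0 := by
  have := sin_mul_sinSum M t
  rw [h, mul_zero] at this
  exact (mul_eq_zero.1 this.symm).resolve_right h'

/-- Here `sin (M t) = 0` and `sin t ≠ 0`, so the differentiated identity gives `cosSum M t = -M cos²
(M t) = -M`. -/
lemma cosSum_neg {M : ℕ} (hM : 2 ≤ M) {t : ℝ} (h : sinSum M t = 0)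
    (h' : Real.sin ((M - 1) * t) ≠ 0) : cosSum M t < 0 := by
  have hM' : (2 : ℝ) ≤ M := by exact_mod_cast hM
  have hs := sin_natCast_mul_eq_zero_of_sinSum h h'
  have ht : Real.sin t ≠ 0 := fun ht => h' <| by
    have := sin_nat_mul_eq_zero ht (M - 1)
    rwa [Nat.cast_sub (by omega), Nat.cast_one] at this
  have h1 := cos_mul_sinSum_add M t
  rw [h, hs, show ((M : ℝ) - 1) * t = M * t - t by ring, Real.sin_sub, hs] at h1
  have h2 : cosSum M t = -(M * Real.cos (M * t) ^ 2) := by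
    apply mul_left_cancel₀ ht
    linarith
  have h3 := Real.sin_sq_add_cos_sq (M * t)
  rw [hs] at h3
  rw [h2]
  nlinarith

/-! ### Zeros of the drift and their stability -/

lemma drift_eq (M : ℕ) (d lam v x : ℝ) :
    drift M d lam v x = -(1 / Real.sqrt M) * sinSum M (Real.pi * d / lam * (v - x)) := by
  unfold drift sinSum
  congr 1
  rw [dotProduct, Complex.im_sum,
    ← Fin.sum_univ_eq_sum_range fun m => Real.sin (2 * m * (Real.pi * d / lam * (v - x)))]
  refine Finset.sum_congr rfl fun m _ => ?_
  rw [Pi.star_apply, steering, steering, star_star, Complex.star_def, ← Complex.exp_conj,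
    ← Complex.exp_add]
  have : Complex.I * ((2 * Real.pi * d / lam * (m : ℕ) * v : ℝ) : ℂ) +
      (starRingEnd ℂ) (Complex.I * ((2 * Real.pi * d / lam * (m : ℕ) * x : ℝ) : ℂ)) =
      ((2 * (m : ℕ) * (Real.pi * d / lam * (v - x)) : ℝ) : ℂ) * Complex.I := by
    rw [map_mul, Complex.conj_I, Complex.conj_ofReal]
    push_cast
    ring
  rw [this, Complex.exp_ofReal_mul_I_im]

lemma hasDerivAt_drift (M : ℕ) (d lam v x : ℝ) :
    HasDerivAt (fun u => drift M d lam u x) (-(1 / Real.sqrt M) *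
      (cosSum M (Real.pi * d / lam * (v - x)) * (Real.pi * d / lam))) v := by
  have h : (fun u => drift M d lam u x) =
      fun u => -(1 / Real.sqrt M) * sinSum M (Real.pi * d / lam * (u - x)) :=
    funext fun u => drift_eq M d lam u x
  rw [h]
  refine HasDerivAt.const_mul _ ?_
  refine (hasDerivAt_sinSum M _).comp v ?_
  simpa using ((hasDerivAt_id v).sub_const x).const_mul (Real.pi * d / lam)

lemma continuous_drift (M : ℕ) (d lam x : ℝ) : Continuous fun u => drift M d lam u x :=
  continuous_iff_continuousAt.2 fun v => (hasDerivAt_drift M d lam v x).continuousAt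

section Zeros

variable {M : ℕ} {d lam : ℝ}

lemma sin_mul_sub_eq_zero_iff (hd : 0 < d) (hlam : 0 < lam) {N : ℝ} (hN : 0 < N) (v x : ℝ) :
    Real.sin (N * (Real.pi * d / lam * (v - x))) = 0 ↔ ∃ k : ℤ, v = x + k * lam / (N * d) := by
  rw [Real.sin_eq_zero_iff]
  refine exists_congr fun k => ?_
  have := Real.pi_pos
  constructor
  · intro h
    have h1 : k * lam = N * d * (v - x) := by
      field_simp at h
      linarith
    rw [h1]
    field_simp
    ring
  · rintro rfl
    field_simp
    ring

lemma drift_eq_zero_iff (hM : 2 ≤ M) (v x : ℝ) :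
    drift M d lam v x = 0 ↔ sinSum M (Real.pi * d / lam * (v - x)) = 0 := by
  have : Real.sqrt M ≠ 0 := by
    have : (0 : ℝ) < M := by exact_mod_cast (by omega : 0 < M)
    positivity
  rw [drift_eq]
  simp [this]

lemma sub_one_pos_of_two_le (hM : 2 ≤ M) : (0 : ℝ) < (M : ℝ) - 1 := by
  have : (2 : ℝ) ≤ M := by exact_mod_cast hM
  linarith

lemma deriv_drift_neg (hM : 2 ≤ M) (hd : 0 < d) (hlam : 0 < lam) {v x : ℝ}
    (h : 0 < cosSum M (Real.pi * d / lam * (v - x))) :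
    deriv (fun u => drift M d lam u x) v < 0 := by
  rw [(hasDerivAt_drift M d lam v x).deriv]
  have : (0 : ℝ) < M := by exact_mod_cast (by omega : 0 < M)
  have := Real.pi_pos
  rw [neg_mul]
  exact neg_neg_of_pos (by positivity)

lemma deriv_drift_pos (hM : 2 ≤ M) (hd : 0 < d) (hlam : 0 < lam) {v x : ℝ}
    (h : cosSum M (Real.pi * d / lam * (v - x)) < 0) :
    0 < deriv (fun u => drift M d lam u x) v := by
  rw [(hasDerivAt_drift M d lam v x).deriv]
  have : (0 : ℝ) < M := by exact_mod_cast (by omega : 0 < M)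
  have := Real.pi_pos
  have h1 : 0 < 1 / Real.sqrt M := by positivity
  have h2 := mul_neg_of_neg_of_pos h (show 0 < Real.pi * d / lam by positivity)
  nlinarith

theorem stablePoints_eq (hM : 2 ≤ M) (hd : 0 < d) (hlam : 0 < lam) (x : ℝ) :
    stablePoints M d lam x =
      {v | ∃ k : ℤ, v = x + k * lam / (((M : ℝ) - 1) * d)} ∩ Set.Ioc (-1 : ℝ) 1 := by
  ext v
  rw [Set.inter_comm]
  refine and_congr_right fun _ => ?_
  change _ ↔ ∃ k : ℤ, v = x + k * lam / (((M : ℝ) - 1) * d)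
  rw [← sin_mul_sub_eq_zero_iff hd hlam (sub_one_pos_of_two_le hM), drift_eq_zero_iff hM]
  constructor
  · rintro ⟨h0, hneg⟩
    by_contra hs
    exact (deriv_drift_pos hM hd hlam (cosSum_neg hM h0 hs)).not_gt hneg
  · intro hs
    exact ⟨sinSum_eq_zero_of_sin hs, deriv_drift_neg hM hd hlam (cosSum_pos hM hs)⟩

lemma countable_setOf_drift_eq_zero (hM : 2 ≤ M) (hd : 0 < d) (hlam : 0 < lam) (x : ℝ) :
    {v | drift M d lam v x = 0}.Countable := by
  refine ((Set.countable_range fun k : ℤ => x + k * lam / (((M : ℝ) - 1) * d)).union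
    (Set.countable_range fun k : ℤ => x + k * lam / ((M : ℝ) * d))).mono fun v hv => ?_
  have h0 := (drift_eq_zero_iff hM v x).1 hv
  by_cases hs : Real.sin ((M - 1) * (Real.pi * d / lam * (v - x))) = 0
  · obtain ⟨k, hk⟩ := (sin_mul_sub_eq_zero_iff hd hlam (sub_one_pos_of_two_le hM) v x).1 hs
    exact Or.inl ⟨k, hk.symm⟩
  · have hM0 : (0 : ℝ) < M := by exact_mod_cast (by omega : 0 < M)
    obtain ⟨k, hk⟩ := (sin_mul_sub_eq_zero_iff hd hlam hM0 v x).1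
      (sin_natCast_mul_eq_zero_of_sinSum h0 hs)
    exact Or.inr ⟨k, hk.symm⟩

/-- A zero of the mean update direction in `(-1, 1)` is a stable point or a point of increase. -/
lemma mem_stablePoints_or_monotoneOn (hM : 2 ≤ M) (hd : 0 < d) (hlam : 0 < lam) {v x : ℝ}
    (hv : v ∈ Set.Ioo (-1 : ℝ) 1) (h : drift M d lam v x = 0) :
    v ∈ stablePoints M d lam x ∨ ∃ U ∈ 𝓝 v, MonotoneOn (fun u => drift M d lam u x) U := by
  have h0 := (drift_eq_zero_iff hM v x).1 h
  by_cases hs : Real.sin ((M - 1) * (Real.pi * d / lam * (v - x))) = 0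
  · exact Or.inl ⟨Set.Ioo_subset_Ioc_self hv, h, deriv_drift_neg hM hd hlam (cosSum_pos hM hs)⟩
  · right
    have hc : Continuous fun u => cosSum M (Real.pi * d / lam * (u - x)) :=
      (continuous_cosSum M).comp (by fun_prop)
    obtain ⟨r, hr, hball⟩ := Metric.eventually_nhds_iff_ball.1
      (hc.continuousAt.eventually (gt_mem_nhds (cosSum_neg hM h0 hs)))
    refine ⟨Metric.ball v r, Metric.ball_mem_nhds v hr,
      monotoneOn_of_deriv_nonneg (convex_ball v r) (continuous_drift M d lam x).continuousOn
        (fun u _ => (hasDerivAt_drift M d lam u x).differentiableAt.differentiableWithinAt)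
        fun u hu => ?_⟩
    rw [Metric.isOpen_ball.interior_eq] at hu
    exact (deriv_drift_pos hM hd hlam (hball u hu)).le

end Zeros

/-! ### Robbins–Monro conditions on the step sizes -/

section StepSize

variable {α N₀ : ℝ}

lemma stepSize_succ_pos (hα : 0 < α) (hN₀ : 0 ≤ N₀) (n : ℕ) : 0 < stepSize α N₀ (n + 1) := by
  unfold stepSize
  push_cast
  positivity

lemma stepSize_succ_le (hα : 0 < α) (hN₀ : 0 ≤ N₀) (n : ℕ) :
    stepSize α N₀ (n + 1) ≤ α * (1 / ((n : ℝ) + 1)) := by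
  unfold stepSize
  push_cast
  rw [mul_one_div]
  exact div_le_div_of_nonneg_left hα.le (by positivity) (by linarith)

lemma tendsto_stepSize_succ (hα : 0 < α) (hN₀ : 0 ≤ N₀) :
    Tendsto (fun n => stepSize α N₀ (n + 1)) atTop (𝓝 0) := by
  refine squeeze_zero (fun n => (stepSize_succ_pos hα hN₀ n).le) (stepSize_succ_le hα hN₀) ?_
  simpa using (tendsto_one_div_add_atTop_nhds_zero_nat (𝕜 := ℝ)).const_mul α

lemma not_summable_stepSize_succ (hα : 0 < α) (hN₀ : 0 ≤ N₀) :
    ¬ Summable fun n => stepSize α N₀ (n + 1) := by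
  intro h
  -- The comparison with the harmonic series uses `n + 1 + N₀ ≤ (1 + N₀) (n + 1)`.
  have h1 : Summable fun n : ℕ => α / (1 + N₀) * (1 / ((n + 1 : ℕ) : ℝ)) := by
    refine h.of_nonneg_of_le (fun n => by positivity) fun n => ?_
    unfold stepSize
    rw [div_mul_div_comm, mul_one]
    push_cast
    refine div_le_div_of_nonneg_left hα.le (by positivity) ?_
    nlinarith [mul_nonneg hN₀ (Nat.cast_nonneg (α := ℝ) n)]
  rw [summable_mul_left_iff (by positivity)] at h1
  exact Real.not_summable_one_div_natCast ((summable_nat_add_iff 1).1 h1)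

lemma summable_stepSize_succ_sq (hα : 0 < α) (hN₀ : 0 ≤ N₀) :
    Summable fun n => stepSize α N₀ (n + 1) ^ 2 := by
  have h1 : Summable fun n : ℕ => α ^ 2 * (1 / ((n + 1 : ℕ) : ℝ) ^ 2) :=
    ((summable_nat_add_iff 1).2 (Real.summable_one_div_nat_pow.2 one_lt_two)).mul_left _
  refine h1.of_nonneg_of_le (fun n => sq_nonneg _) fun n => ?_
  have := pow_le_pow_left₀ (stepSize_succ_pos hα hN₀ n).le (stepSize_succ_le hα hN₀ n) 2
  rw [mul_pow, div_pow, one_pow] at this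
  exact_mod_cast this

end StepSize

/-! ### The tracker as an instance of the scheme -/

lemma observation_beamformer_im (M : ℕ) (d lam ρ x v : ℝ) (z : ℂ) :
    (observation M d lam ρ x (beamformer M d lam v) z).im =
      -(drift M d lam v x + -(1 / Real.sqrt ρ) * z.im) := by
  unfold observation beamformer drift
  rw [Complex.add_im, Complex.div_ofReal_im, star_smul, smul_dotProduct, Complex.star_def,
    Complex.conj_ofReal, smul_eq_mul, Complex.im_ofReal_mul]
  ring

lemma estimate_eq_projIter (M : ℕ) (d lam ρ x α N₀ x₀ : ℝ) (z : ℕ → ℂ) :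
    estimate M d lam ρ x α N₀ x₀ z = projIter (fun v => drift M d lam v x)
      (fun n => stepSize α N₀ (n + 1)) x₀ fun n => -(1 / Real.sqrt ρ) * (z n).im := by
  ext n
  induction n with
  | zero => rfl
  | succ n ih =>
    rw [estimate, projIter, ← ih, observation_beamformer_im]
    congr 1
    ring

lemma stdComplexGaussian_map_im : stdComplexGaussian.map Complex.im = gaussianReal 0 (1 / 2) := by
  unfold stdComplexGaussian
  have h : Measurable fun p : ℝ × ℝ => (⟨p.1, p.2⟩ : ℂ) :=
    Complex.measurableEquivRealProd.symm.measurable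
  rw [Measure.map_map Complex.measurable_im h]
  change Measure.map Prod.snd _ = _
  rw [Measure.map_snd_prod]
  simp

end BeamTracking

open BeamTracking in
theorem theorem1 {Ω : Type*} [MeasurableSpace Ω] (P : Measure Ω) [IsProbabilityMeasure P]
    (M : ℕ) (hM : 2 ≤ M) (d lam ρ : ℝ) (hd : 0 < d) (hlam : 0 < lam) (hρ : 0 < ρ)
    (x : ℝ) (hx : x ∈ Set.Icc (-1 : ℝ) 1)
    (z : ℕ → Ω → ℂ) (hz : ∀ n, HasLaw (z n) BeamTracking.stdComplexGaussian P)
    (hzi : iIndepFun z P)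
    (x₀ : Ω → ℝ) (hx₀m : AEMeasurable x₀ P) (hx₀ : ∀ᵐ ω ∂P, x₀ ω ∈ Set.Icc (-1 : ℝ) 1)
    (hx₀i : IndepFun x₀ (fun ω n => z n ω) P)
    (α N₀ : ℝ) (hα : 0 < α) (hN₀ : 0 ≤ N₀) :
    BeamTracking.stablePoints M d lam x =
        {v | ∃ k : ℤ, v = x + k * lam / (((M : ℝ) - 1) * d)} ∩ Set.Ioc (-1 : ℝ) 1 ∧
      ∀ᵐ ω ∂P, ∃! v : ℝ, v ∈ BeamTracking.stablePoints M d lam x ∪ {-1} ∪ {1} ∧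
        Tendsto (BeamTracking.estimate M d lam ρ x α N₀ (x₀ ω) (fun n => z n ω)) atTop (𝓝 v) := by
  refine ⟨stablePoints_eq hM hd hlam x, ?_⟩
  set b : ℝ := -(1 / Real.sqrt ρ) with hb
  have hb0 : b ≠ 0 := by
    have : 0 < Real.sqrt ρ := Real.sqrt_pos.2 hρ
    exact neg_ne_zero.2 (by positivity)
  obtain ⟨w, hw, hmap⟩ : ∃ w : NNReal, w ≠ 0 ∧
      (gaussianReal 0 (1 / 2)).map (b * ·) = gaussianReal 0 w := by
    refine ⟨_, ?_, by rw [gaussianReal_map_const_mul, mul_zero]⟩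
    refine mul_ne_zero ?_ (by norm_num)
    exact fun h => hb0 (by simpa using congrArg NNReal.toReal h)
  set γ := gaussianReal 0 w with hγ
  have : NullSingletonClass γ := nullSingletonClass_gaussianReal hw
  let g : ℂ → ℝ := fun c => b * c.im
  have hg : Measurable g := Complex.measurable_im.const_mul b
  have hlaw : ∀ n, HasLaw (fun ω => g (z n ω)) γ P := fun n => by
    refine ⟨hg.comp_aemeasurable (hz n).aemeasurable, ?_⟩
    have h1 : P.map (fun ω => g (z n ω)) = (P.map (z n)).map g :=
      (AEMeasurable.map_map_of_aemeasurable hg.aemeasurable (hz n).aemeasurable).symm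
    have h2 : stdComplexGaussian.map g = (stdComplexGaussian.map Complex.im).map (b * ·) :=
      (Measure.map_map (measurable_const_mul b) Complex.measurable_im).symm
    rw [h1, (hz n).map_eq, h2, stdComplexGaussian_map_im, hmap]
  have hξm : AEMeasurable (fun ω n => g (z n ω)) P :=
    aemeasurable_pi_iff.2 fun n => (hlaw n).aemeasurable
  have hξ : HasLaw (fun ω n => g (z n ω)) (Measure.infinitePi fun _ : ℕ => γ) P :=
    (hzi.comp (fun _ => g) fun _ => hg).hasLaw_infinitePi hlaw hξm
  have hgm : Measurable fun (c : ℕ → ℂ) n => g (c n) :=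
    measurable_pi_iff.2 fun n => hg.comp (measurable_pi_apply n)
  have hind : IndepFun x₀ (fun ω n => g (z n ω)) P := hx₀i.comp measurable_id hgm
  -- Independence makes the joint law a product, so the result on the product space transfers to
  -- `P`.
  have hjoint : P.map (fun ω => (x₀ ω, fun n => g (z n ω))) =
      (P.map x₀).prod (Measure.infinitePi fun _ : ℕ => γ) := by
    rw [(indepFun_iff_map_prod_eq_prod_map_map hx₀m hξm).1 hind, hξ.map_eq]
  have := Measure.isProbabilityMeasure_map hx₀m
  have hae := ae_exists_tendsto_projIter (P.map x₀) γ (memLp_id_gaussianReal' 2 (by simp))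
    integral_id_gaussianReal ((ae_map_iff hx₀m measurableSet_Icc).2 hx₀)
    (continuous_drift M d lam x) (countable_setOf_drift_eq_zero hM hd hlam x)
    (stepSize_succ_pos hα hN₀) (tendsto_stepSize_succ hα hN₀)
    (not_summable_stepSize_succ hα hN₀) (summable_stepSize_succ_sq hα hN₀)
  rw [← hjoint] at hae
  filter_upwards [ae_of_ae_map (hx₀m.prodMk hξm) hae] with ω ⟨L, hL, hlim, hzero⟩
  rw [estimate_eq_projIter]
  refine ⟨L, ⟨?_, hlim⟩, fun v hv => tendsto_nhds_unique hv.2 hlim⟩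
  rcases hL.1.eq_or_lt with h1 | h1
  · exact Or.inl (Or.inr h1.symm)
  rcases hL.2.eq_or_lt with h2 | h2
  · exact Or.inr h2
  obtain ⟨h0, hmono⟩ := hzero ⟨h1, h2⟩
  rcases mem_stablePoints_or_monotoneOn hM hd hlam ⟨h1, h2⟩ h0 with hS | ⟨U, hU, hUm⟩
  · exact Or.inl (Or.inl hS)
  · exact (hmono U hU hUm).elim
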